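/- Let $n\ge 1$ and let $M\in M_n(\mathbb R)$ be a matrix with zero diagonal, $M_{j,j}=0$ for all $j$, and let $i\in\{1,\dots,n\}$ be such that all the off-diagonal entries of the $i$-th column of $M$ are nonzero: $M_{j,i}\neq 0$ for all $j\neq i$. Then there exist $t_0>0$ and an analytic function $$\big(y^{(\ell)},(y^{(k)})_{k\neq i},y^{(r)}\big):(-t_0,t_0)\to \mathbb{R}^{n\times(n+1)}$$ such that for all $t\in(-t_0,t_0)$ $$y^{(\ell)}_i(t)=y^{(r)}_i(t)=0,\qquad y^{(k)}_k(t)=0\ \text{ for all } k\neq i,$$ and $$e^{t\,Mx\cdot\nabla}=e^{t\,(y^{(\ell)}(t)\cdot x)\partial_{x_i}}\Big(\prod_{k\neq i}e^{t\,(y^{(k)}(t)\cdot x)\partial_{x_k}}\Big)e^{t\,(y^{(r)}(t)\cdot x)\partial_{x_i}}$$ as bounded operators on $L^2(\mathbb R^n)$. The product over $k\neq i$ is the composition of operators taken in increasing order of $k$ from left to right. For an operator $L$ of the form $V\cdot\nabla$ with a linear vector field $V$, acting on $L^2(\mathbb R^n)$ in the sense of distributions with its maximal domain, $(e^{sL})_{s\in\mathbb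 R}$ is the strongly continuous group on $L^2(\mathbb R^n)$ generated by $L$ (it exists for every operator appearing above); in $e^{t(y(t)\cdot x)\partial_{x_k}}$ the generator $(y(t)\cdot x)\partial_{x_k}$ is frozen and the group it generates is evaluated at time $t$. -/

import Mathlib

open MeasureTheory Matrix
open scoped ContDiff

noncomputable section

/-- The Hilbert space `L²(ℝⁿ)` of complex valued functions. -/
abbrev L2 (n : ℕ) : Type :=
  Lp ℂ 2 (volume : Measure (EuclideanSpace ℝ (Fin n)))

/-- The graph of the transport operator `V · ∇ = ∑ₖ Vₖ ∂ₖ` on `L²(ℝⁿ)`, with its maximal domain: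
`u` is in the domain and `V · ∇ u = v` iff `v ∈ L²` and the equality holds in the sense of
distributions, i.e. `∫ v φ = - ∫ u ∑ₖ ∂ₖ (Vₖ φ)` for all test functions `φ`. -/
def TransportGraph {n : ℕ} (V : EuclideanSpace ℝ (Fin n) → EuclideanSpace ℝ (Fin n))
    (u v : L2 n) : Prop :=
  ∀ φ : EuclideanSpace ℝ (Fin n) → ℝ, ContDiff ℝ ∞ φ → HasCompactSupport φ →
    ∫ x, φ x • v x =
      - ∫ x, (∑ k, fderiv ℝ (fun z => V z k * φ z) x (EuclideanSpace.single k 1)) • u x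

/-- `T` is the strongly continuous one-parameter group of bounded operators on `H` whose
infinitesimal generator is the (unbounded) operator with graph `L`. -/
structure IsGroupGeneratedBy {H : Type*} [NormedAddCommGroup H] [NormedSpace ℂ H]
    (L : H → H → Prop) (T : ℝ → H →L[ℂ] H) : Prop where
  map_zero : T 0 = 1
  map_add : ∀ s t, T (s + t) = T s * T t
  continuous_orbit : ∀ u, Continuous fun t => T t u
  generator : ∀ u v, HasDerivAt (fun t => T t u) v 0 ↔ L u v

/-- The operator with graph `L` generates a strongly continuous group. -/
def GeneratesGroup {H : Type*} [NormedAddCommGroup H] [NormedSpace ℂ H]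
    (L : H → H → Prop) : Prop :=
  ∃ T : ℝ → H →L[ℂ] H, IsGroupGeneratedBy L T

open Classical in
/-- `expGroup L t` is `e^{tL}`, the value at time `t` of the strongly continuous group generated
by the operator with graph `L` (there is at most one such group). The value is `0` if `L` does not
generate a group. -/
def expGroup {H : Type*} [NormedAddCommGroup H] [NormedSpace ℂ H]
    (L : H → H → Prop) (t : ℝ) : H →L[ℂ] H :=
  if h : GeneratesGroup L then h.choose t else 0

/-- The operator `M x · ∇` on `L²(ℝⁿ)`. -/
def linearTransport {n : ℕ} (M : Matrix (Fin n) (Fin n) ℝ) : L2 n → L2 n → Prop :=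
  TransportGraph fun x => WithLp.toLp 2 (M *ᵥ x.ofLp)

/-- The operator `(y · x) ∂_{x_k}` on `L²(ℝⁿ)`. -/
def shearTransport {n : ℕ} (y : Fin n → ℝ) (k : Fin n) : L2 n → L2 n → Prop :=
  TransportGraph fun x => EuclideanSpace.single k (y ⬝ᵥ x.ofLp)

end

/-! A trace-free matrix `B` generates the isometric group `u ↦ u ∘ exp (tB)`, and `(y · x) ∂ₖ` with
`yₖ = 0` is the case `B = eₖ yᵀ`, where `B² = 0` and `exp (tB) = 1 + t eₖ yᵀ`. Composition reverses
products, so the claim becomes a factorization of `exp (tM) = 1 + t F(t)`, with `F` analytic and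
`F(0) = M`, into shears whose leftmost factor is the one of `y^(r)`.

Left multiplication by `1 + t eₖ yᵀ` changes only row `k`. Starting from the identity, row `i`
becomes `eᵢ + t l` for an unknown `l` with `lᵢ = 0`; each row `k ≠ i`, in increasing order, becomes
`eₖ + t Fₖ`; finally row `i` becomes `eᵢ + t Fᵢ`. If `A` is the matrix before step `k`, the shear
has `y = Fₖ A⁻¹`, and by Cramer's rule `yₖ = 0` says that `A` with row `k` replaced by `Fₖ` is
singular.

These `n - 1` conditions are affine in `l`. Both their constant and linear parts are divisible by
`t`, since `M` has zero diagonal. After division, the system at `t = 0` is diagonal with entries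
`-Mₖᵢ ≠ 0`, so it has an analytic solution (`exists_analyticAt_row`). The condition on the last
shear is then automatic, because all determinants are one. -/

open scoped Topology
open Filter

/-! ### Strongly continuous groups and uniqueness for a given generator. -/

namespace IsGroupGeneratedBy

variable {H : Type*} [NormedAddCommGroup H] [NormedSpace ℂ H] {L : H → H → Prop}
  {T S : ℝ → H →L[ℂ] H}

theorem apply_add (hT : IsGroupGeneratedBy L T) (s t : ℝ) (u : H) :
    T (s + t) u = T s (T t u) := by
  rw [hT.map_add]; rfl

theorem apply_zero (hT : IsGroupGeneratedBy L T) (u : H) : T 0 u = u := by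
  rw [hT.map_zero]; rfl

theorem domain_invariant (hT : IsGroupGeneratedBy L T) {u v : H} (h : L u v) (t : ℝ) :
    L (T t u) (T t v) := by
  rw [← hT.generator]
  have h2 := ((T t).restrictScalars ℝ).hasFDerivAt.comp_hasDerivAt 0 ((hT.generator u v).2 h)
  refine h2.congr_of_eventuallyEq (Eventually.of_forall fun s => ?_)
  change T s (T t u) = T t (T s u)
  rw [← hT.apply_add, ← hT.apply_add, add_comm]

/-- The averages `h⁻¹ ∫₀ʰ T s u ds` lie in the domain, since shifting the integral leaves only
boundary terms, and they tend to `u` as `h → 0`. -/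
theorem dense_domain [CompleteSpace H] (hT : IsGroupGeneratedBy L T) :
    Dense {u | ∃ v, L u v} := by
  intro u
  have hc := hT.continuous_orbit u
  have hF : ∀ r, HasDerivAt (fun r => ∫ s in (0 : ℝ)..r, T s u) (T r u) r := fun r =>
    intervalIntegral.integral_hasDerivAt_right (hc.intervalIntegrable _ _)
      (hc.stronglyMeasurableAtFilter _ _) hc.continuousAt
  have hd : ∀ h : ℝ, ∃ v, L (∫ s in (0 : ℝ)..h, T s u) v := by
    intro h
    refine ⟨T h u - T 0 u, (hT.generator _ _).1 ?_⟩
    have h1 : HasDerivAt (fun r => ∫ s in (0 : ℝ)..(r + h), T s u) (T h u) 0 :=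
      HasDerivAt.comp_add_const 0 h (by simpa using hF h)
    refine (h1.sub (hF 0)).congr_of_eventuallyEq (Eventually.of_forall fun r => ?_)
    change T r (∫ s in (0 : ℝ)..h, T s u)
      = (∫ s in (0 : ℝ)..(r + h), T s u) - ∫ s in (0 : ℝ)..r, T s u
    rw [← ContinuousLinearMap.intervalIntegral_comp_comm _ (hc.intervalIntegrable _ _)]
    simp_rw [← hT.apply_add]
    rw [intervalIntegral.integral_comp_add_left (fun s => T s u) r,
      intervalIntegral.integral_interval_sub_left (hc.intervalIntegrable _ _)
        (hc.intervalIntegrable _ _), add_zero]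
  have hl := (hF 0).tendsto_slope
  rw [hT.apply_zero] at hl
  refine mem_closure_of_tendsto hl (Eventually.of_forall fun h => ?_)
  obtain ⟨v, hv⟩ := hd h
  refine ⟨(h - 0)⁻¹ • v, ?_⟩
  rw [← hT.generator] at hv ⊢
  have h2 := hv.const_smul (h - 0)⁻¹
  refine h2.congr_of_eventuallyEq (Eventually.of_forall fun r => ?_)
  change T r (slope (fun r => ∫ s in (0 : ℝ)..r, T s u) 0 h) = _
  rw [slope_def_module]
  simp only [intervalIntegral.integral_same, sub_zero, Pi.smul_apply]
  exact ((T r).restrictScalars ℝ).map_smul _ _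

/-- The contributions `v` and `-v` of the two groups cancel. Isometry of `T` keeps `T (-t)` of the
first-order remainder of `S t u` negligible, with no uniform boundedness argument. -/
theorem hasDerivAt_neg_apply (hT : IsGroupGeneratedBy L T) (hS : IsGroupGeneratedBy L S)
    (hn : ∀ t u, ‖T t u‖ = ‖u‖) {u v : H} (h : L u v) :
    HasDerivAt (fun t => T (-t) (S t u)) 0 0 := by
  have hTu : HasDerivAt (fun t => T (-t) u) (-v) 0 := by
    have := ((hT.generator u v).2 h)
    rw [← neg_zero] at this
    simpa [Function.comp_def] using this.scomp (0 : ℝ) (hasDerivAt_neg 0)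
  have hSu := (hS.generator u v).2 h
  have hTv : Tendsto (fun t => T (-t) v) (𝓝 0) (𝓝 v) := by
    have := ((hT.continuous_orbit v).comp continuous_neg).tendsto 0
    simpa [hT.apply_zero, Function.comp_def] using this
  rw [hasDerivAt_iff_isLittleO] at hTu hSu ⊢
  have h1 : (fun t => T (-t) (S t u - S 0 u - (t - 0) • v)) =o[𝓝 0] fun t : ℝ => t - 0 := by
    rw [← Asymptotics.isLittleO_norm_left] at hSu ⊢
    simpa only [hn] using hSu
  have h2 : (fun t : ℝ => (t - 0) • (T (-t) v - v)) =o[𝓝 0] fun t : ℝ => t - 0 := by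
    have : (fun t => T (-t) v - v) =o[𝓝 0] fun _ : ℝ => (1 : ℝ) := by
      rw [Asymptotics.isLittleO_one_iff]
      simpa using hTv.sub_const v
    simpa using (Asymptotics.isBigO_refl (fun t : ℝ => t - 0) (𝓝 0)).smul_isLittleO this
  refine ((h1.add h2).add hTu).congr_left fun t => ?_
  have : T (-t) ((t - 0) • v) = (t - 0) • T (-t) v :=
    ((T (-t)).restrictScalars ℝ).map_smul _ _
  simp only [map_sub, this, hS.apply_zero, neg_zero, hT.apply_zero, smul_zero, smul_neg, smul_sub]
  abel

/-- A strongly continuous isometric group is determined by its generator. -/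
theorem eq_of_isometric [CompleteSpace H] (hT : IsGroupGeneratedBy L T)
    (hS : IsGroupGeneratedBy L S) (hn : ∀ t u, ‖T t u‖ = ‖u‖) : S = T := by
  funext t
  have hD : Set.EqOn (S t) (T t) {u | ∃ v, L u v} := by
    rintro u ⟨v, h⟩
    -- The group laws and invariance of the domain reduce the derivative at `s` to the one at `0`,
    -- applied to `S s u`.
    have hd : ∀ s, HasDerivAt (fun t => T (-t) (S t u)) 0 s := by
      intro s
      have h0 := hT.hasDerivAt_neg_apply hS hn (hS.domain_invariant h s)
      rw [← sub_self s] at h0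
      have h1 : HasDerivAt (fun r => T (-(r - s)) (S (r - s) (S s u))) 0 s :=
        h0.comp_sub_const s s
      have h2 := ((T (-s)).restrictScalars ℝ).hasFDerivAt.comp_hasDerivAt s h1
      rw [_root_.map_zero] at h2
      refine h2.congr_of_eventuallyEq (Eventually.of_forall fun r => ?_)
      change T (-r) (S r u) = T (-s) (T (-(r - s)) (S (r - s) (S s u)))
      rw [← hS.apply_add, ← hT.apply_add]
      congr 2 <;> ring_nf
    have hconst := is_const_of_deriv_eq_zero (fun s => (hd s).differentiableAt)
      (fun s => (hd s).deriv) t 0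
    simp only [neg_zero, hT.apply_zero, hS.apply_zero] at hconst
    rw [← hconst, ← hT.apply_add, add_neg_cancel, hT.apply_zero, hconst]
  exact DFunLike.coe_injective
    ((S t).continuous.ext_on hT.dense_domain (T t).continuous hD)

theorem expGroup_eq [CompleteSpace H] (hT : IsGroupGeneratedBy L T)
    (hn : ∀ t u, ‖T t u‖ = ‖u‖) (t : ℝ) : expGroup L t = T t := by
  have h : GeneratesGroup L := ⟨T, hT⟩
  rw [expGroup, dif_pos h]
  exact congrFun (hT.eq_of_isometric h.choose_spec hn) t

end IsGroupGeneratedBy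

/-! ### Determinants and matrix exponentials. -/

section MatrixCalculus

variable {m : Type*} [Fintype m] [DecidableEq m] {t₀ : ℝ}

theorem AnalyticAt.matrix_det {A : ℝ → Matrix m m ℝ}
    (hA : ∀ i j, AnalyticAt ℝ (fun t => A t i j) t₀) : AnalyticAt ℝ (fun t => (A t).det) t₀ := by
  simp_rw [det_apply']
  refine Finset.analyticAt_fun_sum _ fun σ _ => analyticAt_const.mul ?_
  exact Finset.analyticAt_fun_prod _ fun i _ => hA _ _

theorem differentiable_matrix_det :
    Differentiable ℝ (fun A : m → m → ℝ => (Matrix.of A).det) := by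
  simp_rw [det_apply', of_apply]
  fun_prop

open scoped Matrix.Norms.Operator

theorem hasDerivAt_matrix_exp (B : Matrix m m ℝ) (t : ℝ) :
    HasDerivAt (fun t : ℝ => NormedSpace.exp (t • B)) (NormedSpace.exp (t • B) * B) t :=
  hasDerivAt_exp_smul_const B t

theorem hasDerivAt_matrix_exp' (B : Matrix m m ℝ) (t : ℝ) :
    HasDerivAt (fun t : ℝ => NormedSpace.exp (t • B)) (B * NormedSpace.exp (t • B)) t :=
  hasDerivAt_exp_smul_const' B t

theorem analyticAt_matrix_exp (B : Matrix m m ℝ) (t : ℝ) :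
    AnalyticAt ℝ (fun t : ℝ => NormedSpace.exp (t • B)) t :=
  (NormedSpace.exp_analytic (𝕂 := ℝ) (t • B)).comp_of_eq
    ((analyticAt_id (𝕜 := ℝ)).smul analyticAt_const) rfl

/-- Evaluation of a matrix entry as a continuous linear functional. -/
noncomputable def entryCLM (i j : m) : Matrix m m ℝ →L[ℝ] ℝ :=
  LinearMap.toContinuousLinearMap (Matrix.entryLinearMap ℝ ℝ i j)

theorem hasDerivAt_matrix_exp_entry (B : Matrix m m ℝ) (t : ℝ) (i j : m) :
    HasDerivAt (fun t : ℝ => NormedSpace.exp (t • B) i j) ((NormedSpace.exp (t • B) * B) i j) t :=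
  (entryCLM i j).hasFDerivAt.comp_hasDerivAt t (hasDerivAt_matrix_exp B t)

theorem analyticAt_matrix_exp_entry (B : Matrix m m ℝ) (t : ℝ) (i j : m) :
    AnalyticAt ℝ (fun t : ℝ => NormedSpace.exp (t • B) i j) t :=
  ((entryCLM i j).analyticAt _).comp (analyticAt_matrix_exp B t)

theorem matrix_exp_add_smul (B : Matrix m m ℝ) (s t : ℝ) :
    NormedSpace.exp ((s + t) • B) = NormedSpace.exp (s • B) * NormedSpace.exp (t • B) := by
  rw [add_smul]
  exact Matrix.exp_add_of_commute _ _ ((Commute.refl B).smul_left s |>.smul_right t)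

theorem matrix_exp_zero_smul (B : Matrix m m ℝ) :
    NormedSpace.exp ((0 : ℝ) • B) = 1 := by
  rw [zero_smul, NormedSpace.exp_zero]

/-- The product `exp (sB) (1 - sB)` has zero derivative, and `1 - tB` has inverse `1 + tB`. -/
theorem matrix_exp_smul_of_mul_self_eq_zero {B : Matrix m m ℝ} (hB : B * B = 0) (t : ℝ) :
    NormedSpace.exp (t • B) = 1 + t • B := by
  have h := (fun s => (hasDerivAt_matrix_exp B s).mul
    (((hasDerivAt_id s).smul_const B).const_sub (1 : Matrix m m ℝ)))
  have h1 := is_const_of_deriv_eq_zero (fun s => (h s).differentiableAt)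
      (fun s => by rw [(h s).deriv]; simp [mul_sub, mul_assoc, hB]) t 0
  simp only [Pi.mul_apply, id, zero_smul, NormedSpace.exp_zero, sub_zero, mul_one] at h1
  have h2 : (1 - t • B) * (1 + t • B) = 1 := by simp [sub_mul, mul_add, hB]
  calc NormedSpace.exp (t • B) = NormedSpace.exp (t • B) * ((1 - t • B) * (1 + t • B)) := by
        rw [h2, mul_one]
    _ = 1 + t • B := by rw [← mul_assoc, h1, one_mul]

/-- The curves `exp (tB)` and `1 + tB` agree to first order at `0`, so their determinants have the
same derivative; for the second it is read off the polynomial expansion. -/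
theorem hasDerivAt_det_exp_zero (B : Matrix m m ℝ) :
    HasDerivAt (fun t : ℝ => (NormedSpace.exp (t • B)).det) B.trace 0 := by
  have hd := (differentiable_matrix_det (m := m)
    (fun i j => (1 : Matrix m m ℝ) i j)).hasFDerivAt
  set D := fderiv ℝ (fun A : m → m → ℝ => (Matrix.of A).det) (fun i j => (1 : Matrix m m ℝ) i j)
  have h1 : HasDerivAt (fun t : ℝ => (1 + t • B).det) (D fun i j => B i j) 0 := by
    have hl : HasDerivAt (fun t : ℝ => fun i j => (1 + t • B) i j) (fun i j => B i j) 0 := by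
      refine hasDerivAt_pi.2 fun i => hasDerivAt_pi.2 fun j => ?_
      simpa using ((hasDerivAt_id (0 : ℝ)).mul_const (B i j)).const_add ((1 : Matrix m m ℝ) i j)
    exact hd.comp_hasDerivAt_of_eq (0 : ℝ) hl (by ext i j; simp)
  have h2 : HasDerivAt (fun t : ℝ => (NormedSpace.exp (t • B)).det) (D fun i j => B i j) 0 := by
    have hl : HasDerivAt (fun t : ℝ => fun i j => NormedSpace.exp (t • B) i j)
        (fun i j => B i j) 0 := by
      refine hasDerivAt_pi.2 fun i => hasDerivAt_pi.2 fun j => ?_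
      simpa [NormedSpace.exp_zero] using hasDerivAt_matrix_exp_entry B 0 i j
    exact hd.comp_hasDerivAt_of_eq (0 : ℝ) hl (by ext i j; simp [NormedSpace.exp_zero])
  have h3 : HasDerivAt (fun t : ℝ => (1 + t • B).det) B.trace 0 := by
    have hp := fun t : ℝ => det_one_add_smul t B
    rw [funext hp]
    have hq := ((1 + (Polynomial.X : Polynomial ℝ) • B.map Polynomial.C).det.divX.divX).hasDerivAt 0
    have := (((hasDerivAt_id' (0 : ℝ)).const_mul B.trace).const_add 1).fun_add
      (hq.fun_mul ((hasDerivAt_id' (0 : ℝ)).fun_pow 2))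
    simpa using this
  rwa [h1.unique h3] at h2

theorem det_exp_smul_of_trace_eq_zero {B : Matrix m m ℝ} (hB : B.trace = 0) (t : ℝ) :
    (NormedSpace.exp (t • B)).det = 1 := by
  have hd : ∀ s, HasDerivAt (fun t : ℝ => (NormedSpace.exp (t • B)).det) 0 s := by
    intro s
    have h0 := hasDerivAt_det_exp_zero B
    rw [hB] at h0
    have h1 := (HasDerivAt.comp_sub_const s s (by rwa [sub_self])).const_mul
      (NormedSpace.exp (s • B)).det
    rw [mul_zero] at h1
    refine h1.congr_of_eventuallyEq (Eventually.of_forall fun r => ?_)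
    simp only
    rw [← det_mul, ← matrix_exp_add_smul, add_sub_cancel]
  have := is_const_of_deriv_eq_zero (fun s => (hd s).differentiableAt) (fun s => (hd s).deriv) t 0
  simpa [NormedSpace.exp_zero] using this

/-- The matrix exponential `exp (tB)` of a trace free matrix. -/
noncomputable def expSL (B : Matrix m m ℝ) (hB : B.trace = 0) (t : ℝ) : SpecialLinearGroup m ℝ :=
  ⟨NormedSpace.exp (t • B), det_exp_smul_of_trace_eq_zero hB t⟩

theorem expSL_add (B : Matrix m m ℝ) (hB : B.trace = 0) (s t : ℝ) :
    expSL B hB (s + t) = expSL B hB s * expSL B hB t :=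
  Subtype.ext (matrix_exp_add_smul B s t)

theorem expSL_zero (B : Matrix m m ℝ) (hB : B.trace = 0) : expSL B hB 0 = 1 :=
  Subtype.ext (matrix_exp_zero_smul B)

theorem continuous_matrix_exp_smul (B : Matrix m m ℝ) :
    Continuous fun t : ℝ => NormedSpace.exp (t • B) :=
  continuous_iff_continuousAt.2 fun t => (hasDerivAt_matrix_exp B t).continuousAt

theorem continuous_coe_expSL (B : Matrix m m ℝ) (hB : B.trace = 0) :
    Continuous fun t => (expSL B hB t : Matrix m m ℝ) :=
  continuous_matrix_exp_smul B

end MatrixCalculus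

/-! ### Volume-preserving linear changes of variables on `L²` and their generators. -/

section LinearChange

variable {n : ℕ}

local notation "E" => EuclideanSpace ℝ (Fin n)

/-- The action of a matrix on Euclidean space. -/
noncomputable def matCLM (A : Matrix (Fin n) (Fin n) ℝ) : E →L[ℝ] E :=
  toEuclideanCLM (n := Fin n) (𝕜 := ℝ) A

theorem matCLM_mul_apply (A B : Matrix (Fin n) (Fin n) ℝ) (x : E) :
    matCLM (A * B) x = matCLM A (matCLM B x) := by
  simp [matCLM]

theorem matCLM_one_apply (x : E) : matCLM (1 : Matrix (Fin n) (Fin n) ℝ) x = x := by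
  simp [matCLM]

theorem matCLM_neg_apply (B : Matrix (Fin n) (Fin n) ℝ) (x : E) :
    matCLM (-B) x = -matCLM B x := by
  simp [matCLM]

/-- The linear map sending a matrix to its action on Euclidean space. -/
noncomputable def matCLMLinear : Matrix (Fin n) (Fin n) ℝ →ₗ[ℝ] E →L[ℝ] E where
  toFun := matCLM
  map_add' A B := by simp [matCLM]
  map_smul' c A := by simp [matCLM]

theorem continuous_matCLM :
    Continuous (matCLM : Matrix (Fin n) (Fin n) ℝ → (E →L[ℝ] E)) :=
  (matCLMLinear (n := n)).continuous_of_finiteDimensional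

open scoped Matrix.Norms.Operator in
theorem hasDerivAt_matCLM_exp (B : Matrix (Fin n) (Fin n) ℝ) (x : E) (t : ℝ) :
    HasDerivAt (fun t : ℝ => matCLM (NormedSpace.exp (t • B)) x)
      (matCLM B (matCLM (NormedSpace.exp (t • B)) x)) t := by
  have h := ((LinearMap.toContinuousLinearMap (matCLMLinear (n := n))).hasFDerivAt.comp_hasDerivAt t
    (hasDerivAt_matrix_exp' B t))
  rw [← matCLM_mul_apply]
  exact ((ContinuousLinearMap.apply ℝ E x).hasFDerivAt.comp_hasDerivAt t h)

theorem measurePreserving_matCLM {A : Matrix (Fin n) (Fin n) ℝ} (hA : A.det = 1) :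
    MeasurePreserving (matCLM A) (volume : Measure E) volume := by
  refine ⟨(matCLM A).continuous.measurable, ?_⟩
  have hd : LinearMap.det (matCLM A : E →ₗ[ℝ] E) = 1 := by
    change LinearMap.det (toLin (PiLp.basisFun 2 ℝ (Fin n)) (PiLp.basisFun 2 ℝ (Fin n)) A) = 1
    rw [LinearMap.det_toLin, hA]
  have := Measure.map_linearMap_addHaar_eq_smul_addHaar (volume : Measure E)
    (f := (matCLM A : E →ₗ[ℝ] E)) (by rw [hd]; exact one_ne_zero)
  rw [hd] at this
  simpa using this

/-- The action of a matrix of determinant one on Euclidean space. -/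
noncomputable def slCLM (A : SpecialLinearGroup (Fin n) ℝ) : E →L[ℝ] E := matCLM A.1

theorem slCLM_one_apply (x : E) : slCLM (1 : SpecialLinearGroup (Fin n) ℝ) x = x :=
  matCLM_one_apply x

theorem slCLM_mul_apply (A B : SpecialLinearGroup (Fin n) ℝ) (x : E) :
    slCLM (A * B) x = slCLM A (slCLM B x) :=
  matCLM_mul_apply _ _ x

theorem measurePreserving_slCLM (A : SpecialLinearGroup (Fin n) ℝ) :
    MeasurePreserving (slCLM A) (volume : Measure E) volume :=
  measurePreserving_matCLM A.2

/-- Composition with a matrix of determinant one, as an operator on `L²`. -/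
noncomputable def compSL (A : SpecialLinearGroup (Fin n) ℝ) : L2 n →L[ℂ] L2 n :=
  (Lp.compMeasurePreservingₗᵢ ℂ (slCLM A) (measurePreserving_slCLM A)).toContinuousLinearMap

theorem norm_compSL (A : SpecialLinearGroup (Fin n) ℝ) (u : L2 n) : ‖compSL A u‖ = ‖u‖ :=
  Lp.norm_compMeasurePreserving _ _

theorem coeFn_compSL (A : SpecialLinearGroup (Fin n) ℝ) (u : L2 n) :
    compSL A u =ᵐ[volume] fun x => u (slCLM A x) :=
  Lp.coeFn_compMeasurePreserving _ _

theorem compSL_one : compSL (1 : SpecialLinearGroup (Fin n) ℝ) = 1 := by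
  ext1 u
  refine Lp.ext ((coeFn_compSL _ _).trans (Eventually.of_forall fun x => ?_))
  simp [slCLM_one_apply]

theorem compSL_mul (A B : SpecialLinearGroup (Fin n) ℝ) :
    compSL (A * B) = compSL B * compSL A := by
  ext1 u
  refine Lp.ext ((coeFn_compSL _ _).trans ?_)
  have h2 := (measurePreserving_slCLM B).quasiMeasurePreserving.ae (coeFn_compSL A u)
  filter_upwards [coeFn_compSL B (compSL A u), h2] with x hx hx2
  change _ = compSL B (compSL A u) x
  rw [hx, hx2, slCLM_mul_apply]

theorem continuous_compSL {G : ℝ → SpecialLinearGroup (Fin n) ℝ}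
    (hG : Continuous fun t => (G t : Matrix (Fin n) (Fin n) ℝ)) (u : L2 n) :
    Continuous fun t => compSL (G t) u := by
  have hc : Continuous fun t =>
      (slCLM (G t) : C(E, E)) :=
    ContinuousMap.continuous_of_continuous_uncurry _
      (((continuous_matCLM.comp hG).comp continuous_fst).clm_apply continuous_snd)
  exact continuous_const.compMeasurePreservingLp hc
    (fun t => measurePreserving_slCLM (G t)) (by simp)

theorem integral_comp_slCLM (A : SpecialLinearGroup (Fin n) ℝ) (g : E → ℂ) :
    ∫ x, g (slCLM A x) = ∫ x, g x := by
  refine (measurePreserving_slCLM A).integral_comp ?_ g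
  refine (slCLM _).continuous.measurableEmbedding fun x y hxy => ?_
  have h := congrArg (slCLM A⁻¹) hxy
  simpa only [← slCLM_mul_apply, inv_mul_cancel, slCLM_one_apply] using h

theorem integral_smul_compSL (A : SpecialLinearGroup (Fin n) ℝ) (φ : E → ℝ) (u : L2 n) :
    ∫ x, φ x • (compSL A u) x =
      ∫ x, φ (slCLM A⁻¹ x) • u x := by
  rw [← integral_comp_slCLM A fun x => φ (slCLM A⁻¹ x) • u x]
  refine integral_congr_ae ?_
  filter_upwards [coeFn_compSL A u] with x hx
  rw [hx, ← slCLM_mul_apply, inv_mul_cancel, slCLM_one_apply]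

theorem exists_pairing {φ : E → ℝ} (hφ : Continuous φ) (hc : HasCompactSupport φ) :
    ∃ ℓ : L2 n →L[ℂ] ℂ, ∀ u, ℓ u = ∫ x, φ x • u x := by
  have hm : MemLp (fun x => (φ x : ℂ)) 2 (volume : Measure E) :=
    (Complex.continuous_ofReal.comp hφ).memLp_of_hasCompactSupport
      (hc.comp_left Complex.ofReal_zero)
  refine ⟨innerSL ℂ (hm.toLp _), fun u => ?_⟩
  rw [innerSL_apply_apply, L2.inner_def]
  refine integral_congr_ae ?_
  filter_upwards [hm.coeFn_toLp] with x hx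
  rw [hx]
  simp [mul_comm]

theorem L2.locallyIntegrable (u : L2 n) : LocallyIntegrable u (volume : Measure E) :=
  (Lp.memLp u).locallyIntegrable (by norm_num)

theorem L2.ext_integral {u v : L2 n} (h : ∀ φ : E → ℝ, ContDiff ℝ ∞ φ → HasCompactSupport φ →
    ∫ x, φ x • u x = ∫ x, φ x • v x) : u = v :=
  Lp.ext (ae_eq_of_integral_contDiff_smul_eq u.locallyIntegrable v.locallyIntegrable h)

/-- The divergence of `x ↦ B x` is the trace of `B`, so the zeroth-order term drops out. -/
theorem sum_fderiv_mul {B : Matrix (Fin n) (Fin n) ℝ} (hB : B.trace = 0) {φ : E → ℝ}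
    (hφ : ContDiff ℝ ∞ φ) (x : E) :
    ∑ k, fderiv ℝ (fun z : E => (WithLp.toLp 2 (B *ᵥ z.ofLp) : E) k * φ z) x
      (EuclideanSpace.single k 1) = fderiv ℝ φ x (matCLM B x) := by
  have hd : HasFDerivAt φ (fderiv ℝ φ x) x :=
    (hφ.differentiable (by simp) x).hasFDerivAt
  have hk : ∀ k, fderiv ℝ (fun z : E => (WithLp.toLp 2 (B *ᵥ z.ofLp) : E) k * φ z) x
      (EuclideanSpace.single k 1) =
      matCLM B x k * fderiv ℝ φ x (EuclideanSpace.single k 1) + φ x * B k k := by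
    intro k
    have hl : HasFDerivAt (fun z : E => (WithLp.toLp 2 (B *ᵥ z.ofLp) : E) k)
        ((EuclideanSpace.proj k : E →L[ℝ] ℝ).comp (matCLM B)) x :=
      ((EuclideanSpace.proj k : E →L[ℝ] ℝ).comp (matCLM B)).hasFDerivAt
    rw [(hl.fun_mul hd).fderiv]
    simp [matCLM, ofLp_toEuclideanCLM]
  have hs : matCLM B x = ∑ k, matCLM B x k • EuclideanSpace.single k (1 : ℝ) := by
    ext j
    simp [Pi.single_apply]
  rw [Finset.sum_congr rfl fun k _ => hk k, Finset.sum_add_distrib, ← Finset.mul_sum]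
  have ht : ∑ k, B k k = 0 := hB
  rw [ht, mul_zero, add_zero]
  conv_rhs => rw [hs]
  simp only [map_sum, map_smul, smul_eq_mul]

theorem linearTransport_iff {B : Matrix (Fin n) (Fin n) ℝ} (hB : B.trace = 0) (u v : L2 n) :
    linearTransport B u v ↔ ∀ φ : E → ℝ, ContDiff ℝ ∞ φ → HasCompactSupport φ →
      ∫ x, φ x • v x = -∫ x, fderiv ℝ φ x (matCLM B x) • u x := by
  refine forall₃_congr fun φ hφ hc => ?_
  simp_rw [sum_fderiv_mul hB hφ]

theorem hasDerivAt_integral_comp_exp (B : Matrix (Fin n) (Fin n) ℝ) {φ : E → ℝ}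
    (hφ : ContDiff ℝ ∞ φ) (hc : HasCompactSupport φ) (u : L2 n) :
    HasDerivAt (fun t : ℝ => ∫ x, φ (matCLM (NormedSpace.exp (t • B)) x) • u x)
      (∫ x, fderiv ℝ φ x (matCLM B x) • u x) 0 := by
  have hφ1 : Continuous (fderiv ℝ φ) := hφ.continuous_fderiv (by simp)
  have hg : Continuous fun x => fderiv ℝ φ x (matCLM B x) :=
    hφ1.clm_apply (matCLM B).continuous
  have hgc : HasCompactSupport fun x => fderiv ℝ φ x (matCLM B x) :=
    hc.mono' fun x hx => by
      contrapose hx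
      have := image_eq_zero_of_notMem_tsupport fun h => hx (tsupport_fderiv_subset ℝ h)
      simp [this]
  obtain ⟨C, hC⟩ := hg.bounded_above_of_compact_support hgc
  have hexp : Continuous fun t : ℝ => matCLM (NormedSpace.exp (t • B)) :=
    continuous_matCLM.comp (continuous_matrix_exp_smul B)
  -- For `|t| < 1` the integrand's derivative is supported in this compact set swept by the flow, on
  -- which `u` is integrable; this gives the dominating function.
  set K : Set E := (fun p : ℝ × E => matCLM (NormedSpace.exp (p.1 • B)) p.2) ''
    (Set.Icc (-1) 1 ×ˢ tsupport fun x => fderiv ℝ φ x (matCLM B x)) with hK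
  have hKc : IsCompact K := (isCompact_Icc.prod hgc).image
    ((hexp.comp continuous_fst).clm_apply continuous_snd)
  have hint : Integrable (K.indicator fun x => C * ‖u x‖) (volume : Measure E) :=
    (integrable_indicator_iff hKc.measurableSet).2
      ((u.locallyIntegrable.integrableOn_isCompact hKc).norm.const_mul C)
  have hE0 : ∀ x : E, matCLM (NormedSpace.exp ((0 : ℝ) • B)) x = x := fun x => by
    rw [matrix_exp_zero_smul, matCLM_one_apply]
  have key := hasDerivAt_integral_of_dominated_loc_of_deriv_le (μ := (volume : Measure E))
    (F := fun (t : ℝ) x => φ (matCLM (NormedSpace.exp (t • B)) x) • u x)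
    (F' := fun t x => fderiv ℝ φ (matCLM (NormedSpace.exp (t • B)) x)
      (matCLM B (matCLM (NormedSpace.exp (t • B)) x)) • u x)
    (bound := K.indicator fun x => C * ‖u x‖) (x₀ := (0 : ℝ)) (Metric.ball_mem_nhds 0 one_pos)
    (Eventually.of_forall fun t =>
      (hφ.continuous.comp (matCLM _).continuous).aestronglyMeasurable.smul
        (Lp.aestronglyMeasurable u))
    (by
      simp_rw [hE0]
      exact u.locallyIntegrable.integrable_smul_left_of_hasCompactSupport hφ.continuous hc)
    (by
      simp_rw [hE0]
      exact hg.aestronglyMeasurable.smul (Lp.aestronglyMeasurable u))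
    (Eventually.of_forall fun x t ht => ?_) hint
    (Eventually.of_forall fun x t _ => ?_)
  · simpa only [hE0] using key.2
  · rw [norm_smul]
    by_cases hx : x ∈ K
    · rw [Set.indicator_of_mem hx]
      exact mul_le_mul_of_nonneg_right (hC _) (norm_nonneg _)
    · rw [Set.indicator_of_notMem hx]
      have hz : fderiv ℝ φ (matCLM (NormedSpace.exp (t • B)) x)
          (matCLM B (matCLM (NormedSpace.exp (t • B)) x)) = 0 := by
        by_contra hne
        refine hx ⟨(-t, matCLM (NormedSpace.exp (t • B)) x), ⟨?_, subset_tsupport _ hne⟩, ?_⟩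
        · rw [Metric.mem_ball, dist_zero_right, Real.norm_eq_abs, abs_lt] at ht
          exact ⟨by simp only; linarith, by simp only; linarith⟩
        · simp only
          rw [← matCLM_mul_apply, ← matrix_exp_add_smul, neg_add_cancel, hE0]
      rw [hz, norm_zero, zero_mul]
  · exact ((hφ.differentiable (by simp) _).hasFDerivAt.comp_hasDerivAt t
      (hasDerivAt_matCLM_exp B x t)).smul_const (u x)

theorem hasDerivAt_integral_smul_compSL {B : Matrix (Fin n) (Fin n) ℝ} (hB : B.trace = 0)
    {φ : E → ℝ} (hφ : ContDiff ℝ ∞ φ) (hc : HasCompactSupport φ) (u : L2 n) :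
    HasDerivAt (fun t : ℝ => ∫ x, φ x • (compSL (expSL B hB t) u) x)
      (-∫ x, fderiv ℝ φ x (matCLM B x) • u x) 0 := by
  have h := hasDerivAt_integral_comp_exp (-B) hφ hc u
  simp_rw [matCLM_neg_apply, map_neg, neg_smul, integral_neg] at h
  refine h.congr_of_eventuallyEq (Eventually.of_forall fun t => ?_)
  simp only
  rw [integral_smul_compSL]
  have hi : (expSL B hB t)⁻¹ = expSL B hB (-t) := by
    rw [inv_eq_iff_mul_eq_one, ← expSL_add, add_neg_cancel, expSL_zero]
  rw [hi, smul_neg, ← neg_smul]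
  rfl

/-- The group generated by `B x · ∇` for a trace free matrix `B` is composition with `exp (tB)`. -/
theorem isGroupGeneratedBy_linearTransport {B : Matrix (Fin n) (Fin n) ℝ} (hB : B.trace = 0) :
    IsGroupGeneratedBy (linearTransport B) fun t => compSL (expSL B hB t) where
  map_zero := by rw [expSL_zero, compSL_one]
  map_add s t := by rw [add_comm, expSL_add, compSL_mul]
  continuous_orbit := continuous_compSL (continuous_coe_expSL B hB)
  generator u v := by
    rw [linearTransport_iff hB]
    constructor
    · intro h φ hφ hc
      obtain ⟨ℓ, hℓ⟩ := exists_pairing hφ.continuous hc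
      have h1 := (ℓ.restrictScalars ℝ).hasFDerivAt.comp_hasDerivAt 0 h
      have h2 := hasDerivAt_integral_smul_compSL hB hφ hc u
      simp_rw [← hℓ] at h2
      rw [← hℓ]
      exact h1.unique h2
    · intro h
      have hcont := continuous_compSL (continuous_coe_expSL B hB) v
      have hF : ∀ r, HasDerivAt (fun r => ∫ s in (0 : ℝ)..r, compSL (expSL B hB s) v)
          (compSL (expSL B hB r) v) r := fun r =>
        intervalIntegral.integral_hasDerivAt_right (hcont.intervalIntegrable _ _)
          (hcont.stronglyMeasurableAtFilter _ _) hcont.continuousAt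
      -- The weak equation is integrated in time against test functions; the resulting identity in
      -- `L²` upgrades it to a strong derivative, so the maximal domain is the generator's domain.
      have hu : ∀ t, compSL (expSL B hB t) u =
          u + ∫ s in (0 : ℝ)..t, compSL (expSL B hB s) v := by
        intro t
        refine L2.ext_integral fun φ hφ hc => ?_
        obtain ⟨ℓ, hℓ⟩ := exists_pairing hφ.continuous hc
        have hd : ∀ s, HasDerivAt (fun t => ℓ (compSL (expSL B hB t) u))
            (ℓ (compSL (expSL B hB s) v)) s := by
          intro s
          set A := expSL B hB s
          -- Moving the flow at time `s` onto the test function reduces the derivative at `s` to the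
          -- one at `0`.
          set ψ : E → ℝ := fun x =>
            φ (slCLM A⁻¹ x)
          have hψ : ContDiff ℝ ∞ ψ := hφ.comp (slCLM _).contDiff
          have hψc : HasCompactSupport ψ := by
            refine HasCompactSupport.intro (hc.isCompact.image
              (slCLM A).continuous) fun x hx => ?_
            by_contra hne
            refine hx ⟨_, subset_tsupport _ hne, ?_⟩
            rw [← slCLM_mul_apply, mul_inv_cancel, slCLM_one_apply]
          have h1 := hasDerivAt_integral_smul_compSL hB hψ hψc u
          rw [← h ψ hψ hψc, ← integral_smul_compSL, ← hℓ] at h1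
          have h2 := HasDerivAt.comp_sub_const s s (by rwa [sub_self])
          refine h2.congr_of_eventuallyEq (Eventually.of_forall fun r => ?_)
          simp only
          rw [← integral_smul_compSL, ← hℓ]
          congr 1
          conv_lhs => rw [← sub_add_cancel r s, expSL_add, compSL_mul]
          rfl
        have hz : ∀ s, HasDerivAt (fun t => ℓ (compSL (expSL B hB t) u)
            - ℓ (∫ s in (0 : ℝ)..t, compSL (expSL B hB s) v)) 0 s := by
          intro s
          simpa using (hd s).fun_sub ((ℓ.restrictScalars ℝ).hasFDerivAt.comp_hasDerivAt s (hF s))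
        have := is_const_of_deriv_eq_zero (fun s => (hz s).differentiableAt)
          (fun s => (hz s).deriv) t 0
        simp only [expSL_zero, compSL_one, intervalIntegral.integral_same, map_zero, sub_zero,
          one_apply_eq_self] at this
        rw [← hℓ, ← hℓ, map_add, ← this, sub_add_cancel]
      have h0 := (hF 0).const_add u
      rw [expSL_zero, compSL_one] at h0
      exact h0.congr_of_eventuallyEq (Eventually.of_forall hu)

theorem generatesGroup_linearTransport {B : Matrix (Fin n) (Fin n) ℝ} (hB : B.trace = 0) :
    GeneratesGroup (linearTransport B) :=
  ⟨_, isGroupGeneratedBy_linearTransport hB⟩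

theorem expGroup_linearTransport {B : Matrix (Fin n) (Fin n) ℝ} (hB : B.trace = 0) (t : ℝ) :
    expGroup (linearTransport B) t = compSL (expSL B hB t) :=
  (isGroupGeneratedBy_linearTransport hB).expGroup_eq (fun _ => norm_compSL _) t

theorem shearTransport_eq (y : Fin n → ℝ) (k : Fin n) :
    shearTransport y k = linearTransport (vecMulVec (Pi.single k 1) y) := by
  unfold shearTransport linearTransport
  congr 1
  funext x
  ext j
  simp [vecMulVec_mulVec, Pi.single_apply, mul_comm]

theorem trace_shear {y : Fin n → ℝ} {k : Fin n} (hy : y k = 0) :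
    (vecMulVec (Pi.single k 1) y).trace = 0 := by
  simp [hy]

theorem generatesGroup_shearTransport {y : Fin n → ℝ} {k : Fin n} (hy : y k = 0) :
    GeneratesGroup (shearTransport y k) := by
  rw [shearTransport_eq]
  exact generatesGroup_linearTransport (trace_shear hy)

end LinearChange

/-! ### Analytic factorization of a perturbation of the identity, row by row. -/

section MatrixFactorization

theorem AnalyticAt.exists_eq_mul {f : ℝ → ℝ} (hf : AnalyticAt ℝ f 0) (h0 : f 0 = 0) :
    ∃ g : ℝ → ℝ, AnalyticAt ℝ g 0 ∧ (∀ t, f t = t * g t) ∧ g 0 = deriv f 0 := by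
  obtain ⟨p, hp⟩ := hf
  refine ⟨dslope f 0, ⟨_, hp.has_fpower_series_dslope_fslope⟩, fun t => ?_, dslope_same f 0⟩
  have := sub_smul_dslope f 0 t
  simpa [h0] using this.symm

variable {m : Type*}

theorem AnalyticAt.matrix_vecMul [Fintype m] {A : ℝ → Matrix m m ℝ} {b : ℝ → m → ℝ} {t₀ : ℝ}
    (hA : ∀ i j, AnalyticAt ℝ (fun t => A t i j) t₀) (hb : ∀ j, AnalyticAt ℝ (fun t => b t j) t₀)
    (j : m) : AnalyticAt ℝ (fun t => (b t ᵥ* A t) j) t₀ := by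
  simp only [vecMul, dotProduct]
  exact Finset.analyticAt_fun_sum _ fun a _ => (hb a).mul (hA a j)

variable [DecidableEq m]

theorem AnalyticAt.matrix_updateRow {A : ℝ → Matrix m m ℝ} {b : ℝ → m → ℝ} {t₀ : ℝ} (k : m)
    (hA : ∀ i j, AnalyticAt ℝ (fun t => A t i j) t₀) (hb : ∀ j, AnalyticAt ℝ (fun t => b t j) t₀)
    (i j : m) : AnalyticAt ℝ (fun t => (A t).updateRow k (b t) i j) t₀ := by
  simp only [updateRow_apply]
  split_ifs
  exacts [hb j, hA i j]

/-- The perturbation of the identity by `t` times the matrix whose `i`-th row is `l`, whose rows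
with index in `S` are those of `F`, and whose other rows vanish. -/
def rowPerturb (i : m) (F : Matrix m m ℝ) (l : m → ℝ) (t : ℝ) (S : Finset m) : Matrix m m ℝ :=
  1 + t • of fun j => if j = i then l else if j ∈ S then F j else 0

theorem rowPerturb_congr {i : m} {S S' : Finset m} (h : ∀ j, j ≠ i → (j ∈ S ↔ j ∈ S'))
    (F : Matrix m m ℝ) (l : m → ℝ) (t : ℝ) :
    rowPerturb i F l t S = rowPerturb i F l t S' := by
  unfold rowPerturb
  congr 2
  ext j a
  by_cases hj : j = i <;> simp [hj, h]

theorem rowPerturb_empty (i : m) (F : Matrix m m ℝ) (l : m → ℝ) (t : ℝ) :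
    rowPerturb i F l t ∅ = 1 + t • vecMulVec (Pi.single i 1) l := by
  unfold rowPerturb
  congr 2
  ext j a
  by_cases hj : j = i <;> simp [hj, vecMulVec_apply]

theorem rowPerturb_insert {i k : m} (hk : k ≠ i) {S : Finset m} (hS : k ∉ S)
    (F : Matrix m m ℝ) (l : m → ℝ) (t : ℝ) :
    rowPerturb i F l t (insert k S) =
      rowPerturb i F l t S + t • vecMulVec (Pi.single k 1) (F k) := by
  unfold rowPerturb
  rw [add_assoc, ← smul_add]
  congr 2
  ext j a
  by_cases hj : j = i
  · subst hj; simp [vecMulVec_apply, hk.symm]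
  · by_cases hjk : j = k
    · subst hjk; simp [vecMulVec_apply, hj, hS]
    · simp [vecMulVec_apply, hj, hjk]

theorem rowPerturb_univ [Fintype m] (i : m) (F : Matrix m m ℝ) (l : m → ℝ) (t : ℝ) :
    rowPerturb i F l t Finset.univ + t • vecMulVec (Pi.single i 1) (F i - l) = 1 + t • F := by
  unfold rowPerturb
  rw [add_assoc, ← smul_add]
  congr 2
  ext j a
  by_cases hj : j = i
  · subst hj; simp [vecMulVec_apply]
  · simp [vecMulVec_apply, hj]

theorem rowPerturb_updateRow_self (i : m) (F : Matrix m m ℝ) (l l' : m → ℝ) (t : ℝ)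
    (S : Finset m) : (rowPerturb i F l t S).updateRow i (Pi.single i 1 + t • l') =
      rowPerturb i F l' t S := by
  ext j a
  by_cases hj : j = i
  · subst hj; simp [rowPerturb, one_apply, Pi.single_apply, eq_comm]
  · simp [rowPerturb, hj]

theorem analyticAt_rowPerturb {i : m} {F : ℝ → Matrix m m ℝ} {l : ℝ → m → ℝ} {t₀ : ℝ}
    (hF : ∀ a b, AnalyticAt ℝ (fun t => F t a b) t₀) (hl : ∀ a, AnalyticAt ℝ (fun t => l t a) t₀)
    (S : Finset m) (a b : m) :
    AnalyticAt ℝ (fun t => rowPerturb i (F t) (l t) t S a b) t₀ := by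
  simp only [rowPerturb, Matrix.add_apply, Matrix.smul_apply, of_apply, smul_eq_mul]
  refine analyticAt_const.add (analyticAt_id.mul ?_)
  split_ifs
  exacts [hl b, hF a b, analyticAt_const]

variable [Fintype m]

theorem det_updateRow_eq_vecMul_adjugate (A : Matrix m m ℝ) (i : m) (b : m → ℝ) :
    (A.updateRow i b).det = (b ᵥ* A.adjugate) i := by
  rw [← cramer_transpose_apply, cramer_eq_adjugate_mulVec, ← adjugate_transpose, mulVec_transpose]

theorem AnalyticAt.matrix_adjugate {A : ℝ → Matrix m m ℝ} {t₀ : ℝ}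
    (hA : ∀ i j, AnalyticAt ℝ (fun t => A t i j) t₀) (i j : m) :
    AnalyticAt ℝ (fun t => (A t).adjugate i j) t₀ := by
  simp only [adjugate_apply]
  exact AnalyticAt.matrix_det (AnalyticAt.matrix_updateRow j hA fun _ => analyticAt_const)

/-- The updated matrix has determinant `v k = 0`, so its products with its adjugate vanish on both
sides; the entries are read off from these relations. This gives the linear system at `t = 0`. -/
theorem adjugate_one_updateRow {k i : m} (hk : k ≠ i) {v : m → ℝ} (hv : v k = 0) (a : m) :
    ((1 : Matrix m m ℝ).updateRow k v).adjugate a i = if a = k then -v i else 0 := by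
  set B := (1 : Matrix m m ℝ).updateRow k v with hB
  have hdet : B.det = 0 := by
    rw [hB, det_updateRow_eq_vecMul_adjugate, adjugate_one, vecMul_one, hv]
  split_ifs with ha
  · subst ha
    have h1 := congrFun (congrFun (adjugate_mul B) a) i
    have h2 : B.adjugate a a = 1 := by
      rw [adjugate_apply, hB, updateRow_idem, ← det_one (n := m) (R := ℝ)]
      congr 1
      ext x y
      by_cases hx : x = a
      · subst hx; simp [one_apply, Pi.single_apply, eq_comm]
      · rw [updateRow_ne hx]
    rw [hdet, zero_smul, Matrix.zero_apply, mul_apply,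
      Finset.sum_eq_add a i hk (fun c _ hc => by
        rw [hB, updateRow_ne hc.1, one_apply_ne hc.2, mul_zero]) (by simp) (by simp), h2] at h1
    rw [hB, updateRow_self, updateRow_ne hk.symm, one_apply_eq, ← hB] at h1
    linarith
  · have h1 := congrFun (congrFun (mul_adjugate B) a) i
    rw [hdet, zero_smul, Matrix.zero_apply, mul_apply, Finset.sum_eq_single a (fun c _ hc => by
      rw [hB, updateRow_ne ha, one_apply_ne hc.symm, zero_mul]) (by simp)] at h1
    rwa [hB, updateRow_ne ha, one_apply_eq, one_mul, ← hB] at h1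

/-- As `A.det = 1`, the adjugate is the inverse; using it keeps the coefficients polynomial in the
entries, hence analytic. -/
theorem one_add_shear_mul {A : Matrix m m ℝ} (hA : A.det = 1) (k : m) (v : m → ℝ) (t : ℝ) :
    (1 + t • vecMulVec (Pi.single k 1) (v ᵥ* A.adjugate)) * A =
      A + t • vecMulVec (Pi.single k 1) v := by
  rw [add_mul, one_mul, smul_mul_assoc, vecMulVec_mul, vecMul_vecMul, adjugate_mul, hA, one_smul,
    vecMul_one]

/-- Analytic solvability of a linear system that is invertible at the base point. -/
theorem exists_analyticAt_mulVec_eq {C : ℝ → Matrix m m ℝ} {w : ℝ → m → ℝ} {t₀ : ℝ}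
    (hC : ∀ i j, AnalyticAt ℝ (fun t => C t i j) t₀) (hw : ∀ j, AnalyticAt ℝ (fun t => w t j) t₀)
    (h0 : (C t₀).det ≠ 0) :
    ∃ l : ℝ → m → ℝ, (∀ j, AnalyticAt ℝ (fun t => l t j) t₀) ∧ ∀ᶠ t in 𝓝 t₀, C t *ᵥ l t = w t := by
  have hd := AnalyticAt.matrix_det hC
  refine ⟨fun t => ((C t).det)⁻¹ • ((C t).adjugate *ᵥ w t), fun j => ?_, ?_⟩
  · simp only [Pi.smul_apply, smul_eq_mul, mulVec, dotProduct]
    exact (hd.inv h0).mul (Finset.analyticAt_fun_sum _ fun a _ =>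
      (AnalyticAt.matrix_adjugate hC j a).mul (hw a))
  · filter_upwards [hd.continuousAt.eventually_ne h0] with t ht
    rw [mulVec_smul, mulVec_mulVec, mul_adjugate, smul_mulVec, one_mulVec, smul_smul,
      inv_mul_cancel₀ ht, one_smul]

/-- Expanding along row `i`, condition `k` reads `adj(Bₖ)ᵢᵢ + t ∑ₐ lₐ adj(Bₖ)ₐᵢ = 0`, with `Bₖ`
independent of `l`. The constant term is `t gₖ`, so dividing by `t` leaves a linear system
invertible at `t = 0`. -/
theorem exists_analyticAt_row [LinearOrder m] [LocallyFiniteOrderBot m] {i : m}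
    {F : ℝ → Matrix m m ℝ}
    (hF : ∀ a b, AnalyticAt ℝ (fun t => F t a b) 0) (hdiag : ∀ k, F 0 k k = 0)
    (hi : ∀ k, k ≠ i → F 0 k i ≠ 0) :
    ∃ l : ℝ → m → ℝ, (∀ a, AnalyticAt ℝ (fun t => l t a) 0) ∧ ∀ᶠ t in 𝓝 0, l t i = 0 ∧
      ∀ k, k ≠ i →
        ((rowPerturb i (F t) (l t) t (Finset.Iio k)).updateRow k (F t k)).det = 0 := by
  set B : m → ℝ → Matrix m m ℝ := fun k t =>
    (rowPerturb i (F t) 0 t (Finset.Iio k)).updateRow k (F t k) with hB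
  have hBa : ∀ k a b, AnalyticAt ℝ (fun t => B k t a b) 0 := fun k =>
    AnalyticAt.matrix_updateRow k (analyticAt_rowPerturb hF (fun _ => analyticAt_const) _) (hF k)
  have hadj : ∀ k a b, AnalyticAt ℝ (fun t => (B k t).adjugate a b) 0 := fun k =>
    AnalyticAt.matrix_adjugate (hBa k)
  have hB0 : ∀ k, k ≠ i → ∀ a,
      (B k 0).adjugate a i = if a = k then -F 0 k i else 0 := by
    intro k hk a
    rw [← adjugate_one_updateRow hk (hdiag k)]
    simp [hB, rowPerturb]
  have hg : ∀ k, ∃ g : ℝ → ℝ, AnalyticAt ℝ g 0 ∧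
      (k ≠ i → ∀ t, (B k t).adjugate i i = t * g t) ∧ (k = i → ∀ t, g t = 0) := by
    intro k
    by_cases hk : k = i
    · exact ⟨0, analyticAt_const, fun h => (h hk).elim, fun _ _ => rfl⟩
    · obtain ⟨g, hg, hfg, -⟩ := (hadj k i i).exists_eq_mul (by rw [hB0 k hk, if_neg (Ne.symm hk)])
      exact ⟨g, hg, fun _ => hfg, fun h => (hk h).elim⟩
  choose g hga hg hgi using hg
  -- Row `i` of the system, with right-hand side `0`, encodes `lᵢ = 0`.
  set C : ℝ → Matrix m m ℝ := fun t => of fun k a =>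
    if k = i then (1 : Matrix m m ℝ) k a else (B k t).adjugate a i with hC
  have hCa : ∀ k a, AnalyticAt ℝ (fun t => C t k a) 0 := by
    intro k a
    simp only [hC, of_apply]
    split_ifs
    exacts [analyticAt_const, hadj k a i]
  have hC0 : C 0 = diagonal fun k => if k = i then 1 else -F 0 k i := by
    ext k a
    simp only [hC, of_apply, diagonal_apply]
    by_cases hk : k = i
    · simp [hk, one_apply]
    · simp [hk, hB0 k hk, eq_comm]
  have hdet : (C 0).det ≠ 0 := by
    rw [hC0, det_diagonal]
    refine Finset.prod_ne_zero_iff.2 fun k _ => ?_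
    split_ifs with hk
    exacts [one_ne_zero, neg_ne_zero.2 (hi k hk)]
  obtain ⟨l, hl, hCl⟩ := exists_analyticAt_mulVec_eq hCa
    (w := fun t k => -g k t) (fun k => (hga k).neg) hdet
  refine ⟨l, hl, hCl.mono fun t ht => ⟨?_, fun k hk => ?_⟩⟩
  · have := congrFun ht i
    simp only [hgi i rfl, neg_zero, mulVec, dotProduct, hC, of_apply, if_true] at this
    simpa [one_apply] using this
  · have hrow : (rowPerturb i (F t) (l t) t (Finset.Iio k)).updateRow k (F t k) =
        (B k t).updateRow i (Pi.single i 1 + t • l t) := by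
      simp only [hB]
      rw [updateRow_comm _ hk, rowPerturb_updateRow_self]
    have h1 := congrFun ht k
    have h2 : (C t *ᵥ l t) k = (l t ᵥ* (B k t).adjugate) i := by
      simp only [mulVec, vecMul, dotProduct, hC, of_apply, if_neg hk]
      exact Finset.sum_congr rfl fun a _ => mul_comm _ _
    rw [hrow, det_updateRow_eq_vecMul_adjugate, add_vecMul, smul_vecMul, Pi.add_apply,
      Pi.smul_apply, ← h2, h1, single_one_vecMul, row_apply, hg k hk, smul_eq_mul]
    ring

end MatrixFactorization

/-! ### From matrix products to operator products. -/

section Main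

variable {n : ℕ}

/-- The shear `1 + t eₖ yᵀ`, with `yₖ = 0`, as an element of the special linear group. -/
noncomputable def shearSL {y : Fin n → ℝ} {k : Fin n} (hy : y k = 0) (t : ℝ) :
    SpecialLinearGroup (Fin n) ℝ :=
  expSL (vecMulVec (Pi.single k 1) y) (trace_shear hy) t

theorem coe_shearSL {y : Fin n → ℝ} {k : Fin n} (hy : y k = 0) (t : ℝ) :
    (shearSL hy t).1 = 1 + t • vecMulVec (Pi.single k 1) y :=
  matrix_exp_smul_of_mul_self_eq_zero (by simp [vecMulVec_mul_vecMulVec, hy]) t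

theorem expGroup_shearTransport {y : Fin n → ℝ} {k : Fin n} (hy : y k = 0) (t : ℝ) :
    expGroup (shearTransport y k) t = compSL (shearSL hy t) := by
  rw [shearTransport_eq, expGroup_linearTransport (trace_shear hy)]
  rfl

/-- Induction on the rows still to be treated: `S` holds those already final, and `P` is the current
matrix. Right multiplication of operators is left multiplication of matrices, and `P` having
determinant one makes each shear set the next row. -/
theorem compSL_mul_prod_shears {i : Fin n} {F : Matrix (Fin n) (Fin n) ℝ} {l : Fin n → ℝ} {t : ℝ}
    (h : ∀ k, k ≠ i → ((rowPerturb i F l t (Finset.Iio k)).updateRow k (F k)).det = 0)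
    (L : List {k : Fin n // k ≠ i}) (S : Finset (Fin n)) (hL : L.Pairwise (· < ·))
    (hmem : ∀ j : {k : Fin n // k ≠ i}, j.1 ∈ S ∨ j ∈ L)
    (hlt : ∀ j : {k : Fin n // k ≠ i}, j.1 ∈ S → ∀ k ∈ L, j < k)
    (P : SpecialLinearGroup (Fin n) ℝ) (hP : P.1 = rowPerturb i F l t S) :
    ∃ Q : SpecialLinearGroup (Fin n) ℝ, Q.1 = rowPerturb i F l t Finset.univ ∧
      compSL P * (L.map fun k : {k : Fin n // k ≠ i} => expGroup (shearTransport
        (F k ᵥ* (rowPerturb i F l t (Finset.Iio k)).adjugate) k) t).prod = compSL Q := by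
  induction L generalizing S P with
  | nil =>
    refine ⟨P, hP.trans (rowPerturb_congr (fun j hj => ?_) F l t), by simp⟩
    simpa using hmem ⟨j, hj⟩
  | cons k L ih =>
    rw [List.pairwise_cons] at hL
    have hkS : k.1 ∉ S := fun hk => lt_irrefl _ (hlt k hk k List.mem_cons_self)
    have hS : rowPerturb i F l t S = rowPerturb i F l t (Finset.Iio k.1) := by
      refine rowPerturb_congr (fun j hj => ?_) F l t
      rw [Finset.mem_Iio]
      refine ⟨fun hjS => hlt ⟨j, hj⟩ hjS k List.mem_cons_self, fun hjk => ?_⟩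
      rcases hmem ⟨j, hj⟩ with hjS | hjL
      · exact hjS
      · rcases List.mem_cons.1 hjL with rfl | hjL
        · exact (lt_irrefl _ hjk).elim
        · exact (lt_asymm hjk (hL.1 _ hjL)).elim
    have hy : (F k ᵥ* (rowPerturb i F l t (Finset.Iio k.1)).adjugate) k = 0 := by
      rw [← det_updateRow_eq_vecMul_adjugate]
      exact h k k.2
    have hdet : (rowPerturb i F l t (Finset.Iio k.1)).det = 1 := by
      rw [← hS, ← hP]; exact P.2
    obtain ⟨Q, hQ, hprod⟩ := ih (insert k.1 S) hL.2
      (fun j => by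
        rcases hmem j with hj | hj
        · exact Or.inl (Finset.mem_insert_of_mem hj)
        · rcases List.mem_cons.1 hj with rfl | hj
          · exact Or.inl (Finset.mem_insert_self _ _)
          · exact Or.inr hj)
      (fun j hj k' hk' => by
        rcases Finset.mem_insert.1 hj with hj | hj
        · rw [Subtype.ext hj]; exact hL.1 _ hk'
        · exact hlt j hj k' (List.mem_cons_of_mem _ hk'))
      (shearSL hy t * P) (by
        change (shearSL hy t).1 * P.1 = _
        rw [coe_shearSL, hP, rowPerturb_insert k.2 hkS, hS, one_add_shear_mul hdet])
    refine ⟨Q, hQ, ?_⟩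
    rw [List.map_cons, List.prod_cons, ← mul_assoc, expGroup_shearTransport hy, ← compSL_mul,
      hprod]

theorem mainTheorem5 {n : ℕ} (M : Matrix (Fin n) (Fin n) ℝ)
    (hdiag : ∀ j, M j j = 0) (i : Fin n) (hi : ∀ j, j ≠ i → M j i ≠ 0) :
    ∃ t₀ : ℝ, 0 < t₀ ∧
      ∃ (yl : ℝ → Fin n → ℝ) (y : ℝ → {k : Fin n // k ≠ i} → Fin n → ℝ) (yr : ℝ → Fin n → ℝ),
        AnalyticOnNhd ℝ (fun t => (yl t, y t, yr t)) (Set.Ioo (-t₀) t₀) ∧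
        ∀ t ∈ Set.Ioo (-t₀) t₀,
          (yl t i = 0 ∧ yr t i = 0 ∧ ∀ k : {k : Fin n // k ≠ i}, y t k k = 0) ∧
          (GeneratesGroup (linearTransport M) ∧
            GeneratesGroup (shearTransport (yl t) i) ∧
            GeneratesGroup (shearTransport (yr t) i) ∧
            ∀ k : {k : Fin n // k ≠ i}, GeneratesGroup (shearTransport (y t k) k)) ∧
          expGroup (linearTransport M) t =
            expGroup (shearTransport (yl t) i) t *
              (((Finset.univ : Finset {k : Fin n // k ≠ i}).sort (· ≤ ·)).map
                fun k => expGroup (shearTransport (y t k) k) t).prod *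
              expGroup (shearTransport (yr t) i) t := by
  have hM : M.trace = 0 := Finset.sum_eq_zero fun j _ => hdiag j
  have hF : ∀ a b, ∃ g : ℝ → ℝ, AnalyticAt ℝ g 0 ∧
      (∀ t, NormedSpace.exp (t • M) a b - (1 : Matrix (Fin n) (Fin n) ℝ) a b = t * g t) ∧
      g 0 = M a b := by
    intro a b
    obtain ⟨g, hg, hfg, hg0⟩ := AnalyticAt.exists_eq_mul
      ((analyticAt_matrix_exp_entry M 0 a b).fun_sub
        (analyticAt_const (v := (1 : Matrix (Fin n) (Fin n) ℝ) a b)))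
      (by rw [matrix_exp_zero_smul, sub_self])
    refine ⟨g, hg, hfg, hg0.trans ?_⟩
    rw [((hasDerivAt_matrix_exp_entry M 0 a b).sub_const _).deriv, matrix_exp_zero_smul, one_mul]
  choose G hGa hG hG0 using hF
  set F : ℝ → Matrix (Fin n) (Fin n) ℝ := fun t => of fun a b => G a b t with hFdef
  have hFa : ∀ a b, AnalyticAt ℝ (fun t => F t a b) 0 := hGa
  have hF0 : F 0 = M := by ext a b; exact hG0 a b
  have hexp : ∀ t, NormedSpace.exp (t • M) = 1 + t • F t := by
    intro t
    ext a b
    have := hG a b t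
    simp only [hFdef, Matrix.add_apply, Matrix.smul_apply, of_apply, smul_eq_mul]
    linarith
  obtain ⟨l, hla, hl⟩ := exists_analyticAt_row (i := i) hFa (fun k => by rw [hF0, hdiag])
    (fun k hk => by rw [hF0]; exact hi k hk)
  set y : ℝ → {k : Fin n // k ≠ i} → Fin n → ℝ := fun t k =>
    F t k ᵥ* (rowPerturb i (F t) (l t) t (Finset.Iio k.1)).adjugate with hy
  set yr : ℝ → Fin n → ℝ := fun t =>
    (F t i - l t) ᵥ* (rowPerturb i (F t) (l t) t Finset.univ).adjugate with hyr
  have hana : AnalyticAt ℝ (fun t => (l t, y t, yr t)) 0 := by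
    refine (AnalyticAt.pi hla).prod (AnalyticAt.prod (AnalyticAt.pi fun k => AnalyticAt.pi ?_)
      (AnalyticAt.pi ?_))
    · exact AnalyticAt.matrix_vecMul
        (AnalyticAt.matrix_adjugate (analyticAt_rowPerturb hFa hla _)) (hFa k)
    · exact AnalyticAt.matrix_vecMul
        (AnalyticAt.matrix_adjugate (analyticAt_rowPerturb hFa hla _))
        fun j => (hFa i j).sub (hla j)
  obtain ⟨ε, hε, hball⟩ := Metric.eventually_nhds_iff.1 (hana.eventually_analyticAt.and hl)
  have hIoo : ∀ t ∈ Set.Ioo (-ε) ε, dist t 0 < ε := fun t ht => by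
    rw [Real.dist_0_eq_abs]; exact abs_lt.2 ht
  refine ⟨ε, hε, l, y, yr, fun t ht => (hball (hIoo t ht)).1, fun t ht => ?_⟩
  obtain ⟨-, hli, hdet⟩ := hball (hIoo t ht)
  have hyk : ∀ k : {k : Fin n // k ≠ i}, y t k k = 0 := fun k => by
    simp only [hy]
    rw [← det_updateRow_eq_vecMul_adjugate]
    exact hdet k k.2
  obtain ⟨Q, hQ, hprod⟩ := compSL_mul_prod_shears hdet
    ((Finset.univ : Finset {k : Fin n // k ≠ i}).sort (· ≤ ·)) ∅
    (Finset.sortedLT_sort _).pairwise (fun j => Or.inr (by simp)) (by simp)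
    (shearSL hli t) (by rw [coe_shearSL, rowPerturb_empty])
  have hQdet : (rowPerturb i (F t) (l t) t Finset.univ).det = 1 := by rw [← hQ]; exact Q.2
  have hyri : yr t i = 0 := by
    -- For `t ≠ 0`, the determinant is affine in row `i` and equals one for both `l` and `Fᵢ`; the
    -- difference is `t yr t i`. At `t = 0` the entry is `Mᵢᵢ - lᵢ = 0`.
    by_cases ht0 : t = 0
    · subst ht0
      simp [hyr, rowPerturb, hF0, hdiag, hli]
    · have h1 : (rowPerturb i (F t) (F t i) t Finset.univ).det = 1 := by
        have := rowPerturb_univ i (F t) (F t i) t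
        rw [sub_self, vecMulVec_zero, smul_zero, add_zero] at this
        rw [this, ← hexp, det_exp_smul_of_trace_eq_zero hM]
      have h2 := hQdet
      rw [← rowPerturb_updateRow_self i (F t) (l t), det_updateRow_eq_vecMul_adjugate,
        add_vecMul, smul_vecMul, Pi.add_apply, Pi.smul_apply, smul_eq_mul] at h1 h2
      have h3 : t * yr t i = 0 := by
        simp only [hyr, sub_vecMul, Pi.sub_apply, mul_sub]
        linarith
      exact (mul_eq_zero.1 h3).resolve_left ht0
  refine ⟨⟨hli, hyri, hyk⟩, ⟨generatesGroup_linearTransport hM, generatesGroup_shearTransport hli,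
    generatesGroup_shearTransport hyri, fun k => generatesGroup_shearTransport (hyk k)⟩, ?_⟩
  rw [expGroup_linearTransport hM, expGroup_shearTransport hli, hprod,
    expGroup_shearTransport hyri, ← compSL_mul]
  congr 1
  refine Subtype.ext ?_
  change NormedSpace.exp (t • M) = (shearSL hyri t).1 * Q.1
  rw [coe_shearSL, hQ, hexp]
  simp only [hyr]
  rw [one_add_shear_mul hQdet, rowPerturb_univ]

end Main
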